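/- **Operator-Bernstein inequality.** Let $X_1,\dots,X_m$ be independent, identically distributed random $n\times n$ matrices on a probability space, almost surely Hermitian (complex Hermitian, or real symmetric), with $\mathbb{E}[X_i]=0$. Let $\|\cdot\|$ denote the operator (spectral) norm, and let $V_0, c\in\mathbb{R}$ be such that $\|\mathbb{E}[X_i^2]\|\le V_0^2$ and $\|X_i\|\le c$ almost surely. Set $S=\sum_{i=1}^m X_i$ and $V=mV_0^2$. Then for every real $t$ with $0\le t\le 2V/c$, $$\Pr\big[\|S\|>t\big]\le 2n\exp\Big(-\frac{t^2}{4V}\Big),$$ and for every real $t\ge 0$ with $t>2V/c$, $$\Pr\big[\|S\|>t\big]\le 2n\exp\Big(-\frac{t}{2c}\Big).$$ (In the degenerate cases where $c$ or $V$ is $0$, quotients with denominator $0$ are read as $0$.) -/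

import Mathlib

open MeasureTheory ProbabilityTheory
open scoped Matrix.Norms.L2Operator

/-- The Borel sigma-algebra on matrices: the product sigma-algebra of the entries. -/
instance Matrix.instMeasurableSpacePi {k l 𝕜 : Type*} [MeasurableSpace 𝕜] :
    MeasurableSpace (Matrix k l 𝕜) :=
  MeasurableSpace.pi

/-- The expectation of a random matrix, taken entry by entry. -/
noncomputable def matrixExpectation {Ω 𝕜 : Type*} [RCLike 𝕜] [MeasurableSpace Ω]
    (P : Measure Ω) {n : ℕ} (Y : Ω → Matrix (Fin n) (Fin n) 𝕜) : Matrix (Fin n) (Fin n) 𝕜 :=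
  Matrix.of fun a b => ∫ ω, Y ω a b ∂P

/-!
The proof is the matrix Chernoff method of Ahlswede and Winter. For a Hermitian matrix `S` and
`r ≥ 0`, the number `exp (r ‖S‖)` is at most `tr exp (r S) + tr exp (-r S)`, so by Markov's
inequality it suffices to bound `𝔼 tr exp (r S)` for `S = ∑ i, X i` and both signs of `r`.

The summands do not commute, but the Golden–Thompson inequality
`tr exp (A + B) ≤ tr (exp A * exp B)` (`Matrix.IsHermitian.re_trace_exp_add_le`) allows one
independent summand to be split off at a time. For a Hermitian contraction `Y` one has
`exp Y ≤ 1 + Y + Y²`, hence a centred `Y` with `‖𝔼 Y²‖ ≤ v` which is independent of the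
positive semidefinite `W` satisfies `𝔼 tr (W * exp Y) ≤ (1 + v) 𝔼 tr W`. Iterating gives
`𝔼 tr exp (∑ i, Y i) ≤ n exp (m v)` (`integral_re_trace_exp_sum_le`). With `Y i = ± r X i` this
yields the tail bound `2 n exp (r² V - r t)` whenever `r c ≤ 1` (`measureReal_lt_norm_sum_le`).
The two ranges of `t` correspond to `r = t / (2 V)` and `r = 1 / c`.

Golden–Thompson itself follows from the Lie product formula
(`NormedSpace.tendsto_exp_smul_mul_exp_smul_pow`), taken along the exponents `2 ^ k`, and the
inequality `tr (P Q) ^ 2 ^ k ≤ tr (P ^ 2 ^ k * Q ^ 2 ^ k)` for Hermitian `P` and `Q`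
(`Matrix.re_trace_pow_two_pow_le`), which needs nothing beyond `tr (M * Mᴴ) ≥ 0` and the cyclicity
of the trace.

Over a general `RCLike` field the traces are scalars, so all inequalities are between real parts.
-/

/-! ### Trace inequalities -/

namespace Matrix

variable {ι 𝕜 : Type*} [RCLike 𝕜] [Fintype ι]

lemma re_trace_conjTranspose (M : Matrix ι ι 𝕜) :
    RCLike.re (Mᴴ).trace = RCLike.re M.trace := by
  simp [trace_conjTranspose]

open scoped ComplexOrder in
lemma re_trace_mul_conjTranspose_self_nonneg (M : Matrix ι ι 𝕜) :
    0 ≤ RCLike.re (M * Mᴴ).trace :=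
  (RCLike.nonneg_iff.mp (posSemidef_self_mul_conjTranspose M).trace_nonneg).1

variable [DecidableEq ι]

open scoped ComplexOrder MatrixOrder in
lemma PosSemidef.re_trace_mul_nonneg {A B : Matrix ι ι 𝕜} (hA : A.PosSemidef)
    (hB : B.PosSemidef) : 0 ≤ RCLike.re (A * B).trace := by
  obtain ⟨C, rfl⟩ := CStarAlgebra.nonneg_iff_eq_star_mul_self.mp hB.nonneg
  rw [star_eq_conjTranspose]
  have := (hA.mul_mul_conjTranspose_same C).trace_nonneg
  rw [← Matrix.mul_assoc, Matrix.trace_mul_comm, ← Matrix.mul_assoc]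
  exact (RCLike.nonneg_iff.mp this).1

lemma IsHermitian.two_mul_re_trace_mul_le {P Q : Matrix ι ι 𝕜} (hP : P.IsHermitian)
    (hQ : Q.IsHermitian) :
    2 * RCLike.re (P * Q).trace ≤ RCLike.re (P ^ 2).trace + RCLike.re (Q ^ 2).trace := by
  have h := re_trace_mul_conjTranspose_self_nonneg (P - Q)
  rw [conjTranspose_sub, hP.eq, hQ.eq] at h
  simp only [sub_mul, mul_sub, trace_sub, map_sub, trace_mul_comm Q P] at h
  rw [sq, sq]
  linarith

lemma trace_mul_pow_comm (A B : Matrix ι ι 𝕜) (k : ℕ) :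
    ((A * B) ^ k).trace = ((B * A) ^ k).trace := by
  cases k with
  | zero => simp
  | succ k =>
    have h : (A * B) ^ (k + 1) = A * (B * A) ^ k * B := by
      induction k with
      | zero => simp
      | succ k ih => rw [pow_succ, ih, pow_succ]; simp only [mul_assoc]
    rw [h, trace_mul_comm, ← mul_assoc, pow_succ']

/-- The case `k = 0` of `re_trace_pow_two_pow_le`, a form of the Cauchy–Schwarz inequality. -/
lemma re_trace_sq_le (M : Matrix ι ι 𝕜) :
    RCLike.re (M ^ 2).trace ≤ RCLike.re (M * Mᴴ).trace := by
  have h := re_trace_mul_conjTranspose_self_nonneg (M - Mᴴ)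
  have h2 := re_trace_conjTranspose (M * M)
  rw [conjTranspose_mul] at h2
  have h3 := trace_mul_comm M Mᴴ
  simp only [conjTranspose_sub, conjTranspose_conjTranspose, sub_mul, mul_sub, trace_sub,
    map_sub] at h
  rw [sq]
  rw [← h3] at h
  linarith

/-- The second inequality is Golden–Thompson for the factors of the Lie product formula. The two
are proved by a joint induction, in which the first one for `M ^ 2` leads to the second one for
`Mᴴ * M` and `M * Mᴴ`, and the second one for `P`, `Q` follows from the first one for `P * Q` and
the second one for `P ^ 2`, `Q ^ 2`. -/
lemma re_trace_pow_two_pow_le (k : ℕ) :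
    (∀ M : Matrix ι ι 𝕜, RCLike.re (M ^ 2 ^ (k + 1)).trace ≤
      RCLike.re ((M * Mᴴ) ^ 2 ^ k).trace) ∧
    (∀ P Q : Matrix ι ι 𝕜, P.IsHermitian → Q.IsHermitian →
      RCLike.re ((P * Q) ^ 2 ^ k).trace ≤ RCLike.re (P ^ 2 ^ k * Q ^ 2 ^ k).trace) := by
  induction k with
  | zero => exact ⟨fun M => by simpa using re_trace_sq_le M, fun P Q _ _ => by simp⟩
  | succ k ih =>
    obtain ⟨iha, ihb⟩ := ih
    refine ⟨fun M => ?_, fun P Q hP hQ => ?_⟩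
    · have hP : (Mᴴ * M).IsHermitian := isHermitian_conjTranspose_mul_self M
      have hQ : (M * Mᴴ).IsHermitian := isHermitian_mul_conjTranspose_self M
      have h1 := iha (M ^ 2)
      have h2 : ((M ^ 2 * (M ^ 2)ᴴ) ^ 2 ^ k).trace = ((Mᴴ * M * (M * Mᴴ)) ^ 2 ^ k).trace := by
        rw [conjTranspose_pow, sq, sq, ← mul_assoc, trace_mul_pow_comm]
        simp only [mul_assoc]
      have h3 := ihb _ _ hP hQ
      have h4 := (hP.pow (2 ^ k)).two_mul_re_trace_mul_le (hQ.pow (2 ^ k))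
      rw [← pow_mul, ← pow_mul, ← pow_succ, trace_mul_pow_comm Mᴴ] at h4
      rw [h2, ← pow_mul, ← pow_succ'] at h1
      linarith
    · have h1 := iha (P * Q)
      rw [conjTranspose_mul, hP.eq, hQ.eq] at h1
      have h2 : ((P * Q * (Q * P)) ^ 2 ^ k).trace = ((P ^ 2 * Q ^ 2) ^ 2 ^ k).trace := by
        rw [← mul_assoc, trace_mul_pow_comm, sq, sq]
        simp only [mul_assoc]
      have h3 := ihb _ _ (hP.pow 2) (hQ.pow 2)
      rw [h2] at h1
      simp only [← pow_mul, ← pow_succ'] at h3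
      exact h1.trans h3

end Matrix

/-! ### The Lie product formula -/

section LieProduct

open Filter Topology

lemma norm_pow_sub_pow_le_of_norm_le {𝔸 : Type*} [NormedRing 𝔸] [NormOneClass 𝔸] {x y : 𝔸}
    {R : ℝ} (hx : ‖x‖ ≤ R) (hy : ‖y‖ ≤ R) (n : ℕ) :
    ‖x ^ (n + 1) - y ^ (n + 1)‖ ≤ (n + 1) * R ^ n * ‖x - y‖ := by
  have hR : 0 ≤ R := (norm_nonneg x).trans hx
  induction n with
  | zero => simp
  | succ n ih =>
    have h : x ^ (n + 1 + 1) - y ^ (n + 1 + 1)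
        = x ^ (n + 1) * (x - y) + (x ^ (n + 1) - y ^ (n + 1)) * y := by
      rw [pow_succ x (n + 1), pow_succ y (n + 1)]; noncomm_ring
    have h1 : ‖x ^ (n + 1) * (x - y)‖ ≤ R ^ (n + 1) * ‖x - y‖ :=
      (norm_mul_le _ _).trans (by gcongr; exact (norm_pow_le _ _).trans (by gcongr))
    have h2 : ‖(x ^ (n + 1) - y ^ (n + 1)) * y‖ ≤ (n + 1) * R ^ n * ‖x - y‖ * R :=
      (norm_mul_le _ _).trans (by gcongr)
    rw [h]
    refine (norm_add_le _ _).trans ((add_le_add h1 h2).trans (le_of_eq ?_))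
    push_cast; ring

lemma NormedSpace.norm_exp_le_exp_norm (𝕜 : Type*) {𝔸 : Type*} [RCLike 𝕜] [NormedRing 𝔸]
    [NormOneClass 𝔸] [NormedAlgebra 𝕜 𝔸] (x : 𝔸) : ‖NormedSpace.exp x‖ ≤ Real.exp ‖x‖ := by
  rw [NormedSpace.exp_eq_tsum 𝕜, Real.exp_eq_exp_ℝ, NormedSpace.exp_eq_tsum ℝ]
  refine (norm_tsum_le_tsum_norm (NormedSpace.norm_expSeries_summable' (𝕂 := 𝕜) x)).trans ?_
  refine (NormedSpace.norm_expSeries_summable' (𝕂 := 𝕜) x).tsum_le_tsum (fun n => ?_)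
    (NormedSpace.expSeries_summable' (𝕂 := ℝ) ‖x‖)
  rw [norm_smul, smul_eq_mul]
  gcongr
  · simp
  · exact norm_pow_le _ _

/-- The **Lie product formula**. -/
theorem NormedSpace.tendsto_exp_smul_mul_exp_smul_pow (𝕜 : Type*) {𝔸 : Type*} [RCLike 𝕜]
    [NormedRing 𝔸] [NormOneClass 𝔸] [NormedAlgebra 𝕜 𝔸] [CompleteSpace 𝔸] (A B : 𝔸) :
    Tendsto (fun n : ℕ => (NormedSpace.exp (((n : 𝕜) + 1)⁻¹ • A) *
      NormedSpace.exp (((n : 𝕜) + 1)⁻¹ • B)) ^ (n + 1)) atTop (𝓝 (NormedSpace.exp (A + B))) := by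
  -- The error of one step of length `s`; it vanishes to first order at `s = 0`.
  set f : 𝕜 → 𝔸 := fun s => NormedSpace.exp (s • A) * NormedSpace.exp (s • B) -
    NormedSpace.exp (s • (A + B)) with hf
  have hf0 : f 0 = 0 := by simp [hf]
  have hd : HasDerivAt f 0 0 := by
    have h := ((hasDerivAt_exp_smul_const A (0 : 𝕜)).mul
      (hasDerivAt_exp_smul_const B (0 : 𝕜))).sub (hasDerivAt_exp_smul_const (A + B) (0 : 𝕜))
    exact h.congr_deriv (by simp)
  have hs : Tendsto (fun n : ℕ => ((n : 𝕜) + 1)⁻¹) atTop (𝓝[≠] 0) := by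
    refine tendsto_nhdsWithin_iff.mpr ⟨?_, ?_⟩
    · simpa using tendsto_one_div_add_atTop_nhds_zero_nat (𝕜 := 𝕜)
    · exact Eventually.of_forall fun n => inv_ne_zero (Nat.cast_add_one_ne_zero n)
  have hlim := (hd.tendsto_slope_zero.comp hs).norm
  simp only [Function.comp_def, zero_add, hf0, sub_zero, inv_inv, norm_zero] at hlim
  have hlim' := hlim.const_mul (Real.exp (‖A‖ + ‖B‖))
  rw [mul_zero] at hlim'
  rw [tendsto_iff_norm_sub_tendsto_zero]
  refine squeeze_zero (fun _ => norm_nonneg _) (fun n => ?_) hlim'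
  have hn : ‖((n : 𝕜) + 1)⁻¹‖ = ((n : ℝ) + 1)⁻¹ := by
    rw [norm_inv]; congr 1; exact_mod_cast RCLike.norm_natCast (K := 𝕜) (n + 1)
  set s : 𝕜 := ((n : 𝕜) + 1)⁻¹ with hsdef
  set K := ‖A‖ + ‖B‖
  have hexp : NormedSpace.exp (A + B) = NormedSpace.exp (s • (A + B)) ^ (n + 1) := by
    let _ := NormedAlgebra.restrictScalars ℚ 𝕜 𝔸
    rw [← NormedSpace.exp_nsmul, ← Nat.cast_smul_eq_nsmul 𝕜, smul_smul, hsdef]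
    push_cast
    rw [mul_inv_cancel₀ (Nat.cast_add_one_ne_zero n), one_smul]
  set R := Real.exp (((n : ℝ) + 1)⁻¹ * K)
  have hx : ‖NormedSpace.exp (s • A) * NormedSpace.exp (s • B)‖ ≤ R := by
    refine (norm_mul_le _ _).trans ((mul_le_mul (norm_exp_le_exp_norm 𝕜 _)
      (norm_exp_le_exp_norm 𝕜 _) (norm_nonneg _) (Real.exp_nonneg _)).trans (le_of_eq ?_))
    rw [← Real.exp_add, norm_smul, norm_smul, hn, ← mul_add]
  have hy : ‖NormedSpace.exp (s • (A + B))‖ ≤ R := by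
    refine (norm_exp_le_exp_norm 𝕜 _).trans (Real.exp_le_exp.mpr ?_)
    rw [norm_smul, hn]
    gcongr
    exact norm_add_le _ _
  have hR : R ^ n ≤ Real.exp K := by
    rw [← Real.exp_nat_mul]
    refine Real.exp_le_exp.mpr ?_
    have hK0 : 0 ≤ K := by positivity
    rw [← mul_assoc]
    refine mul_le_of_le_one_left hK0 ?_
    rw [← div_eq_mul_inv, div_le_one (by positivity)]
    linarith
  rw [hexp]
  refine (norm_pow_sub_pow_le_of_norm_le hx hy n).trans ?_
  rw [norm_smul, show ‖(n : 𝕜) + 1‖ = (n : ℝ) + 1 by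
    exact_mod_cast RCLike.norm_natCast (K := 𝕜) (n + 1), ← mul_assoc, mul_comm (Real.exp K)]
  gcongr

end LieProduct

/-! ### The Golden–Thompson inequality -/

namespace Matrix

variable {ι 𝕜 : Type*} [RCLike 𝕜] [Fintype ι] [DecidableEq ι]

open Filter Topology in
/-- The **Golden–Thompson inequality**. -/
theorem IsHermitian.re_trace_exp_add_le {A B : Matrix ι ι 𝕜} (hA : A.IsHermitian)
    (hB : B.IsHermitian) :
    RCLike.re (NormedSpace.exp (A + B)).trace ≤
      RCLike.re (NormedSpace.exp A * NormedSpace.exp B).trace := by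
  cases isEmpty_or_nonempty ι
  · simp [trace]
  have : CompleteSpace (Matrix ι ι 𝕜) := FiniteDimensional.complete 𝕜 _
  have hpow : Tendsto (fun k : ℕ => 2 ^ k - 1) atTop atTop :=
    (tendsto_sub_atTop_nat 1).comp (tendsto_pow_atTop_atTop_of_one_lt one_lt_two)
  have hlim := (NormedSpace.tendsto_exp_smul_mul_exp_smul_pow 𝕜 A B).comp hpow
  have hcont : Continuous fun M : Matrix ι ι 𝕜 => RCLike.re M.trace :=
    RCLike.continuous_re.comp continuous_id.matrix_trace
  refine le_of_tendsto ((hcont.tendsto _).comp hlim) (Eventually.of_forall fun k => ?_)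
  have hk : 2 ^ k - 1 + 1 = 2 ^ k := Nat.sub_add_cancel Nat.one_le_two_pow
  have hk' : ((2 ^ k - 1 : ℕ) : 𝕜) + 1 = ((2 ^ k : ℕ) : 𝕜) := by
    rw [← Nat.cast_add_one, hk]
  simp only [Function.comp_apply, hk, hk']
  set s : 𝕜 := ((2 ^ k : ℕ) : 𝕜)⁻¹ with hs
  have hstar : IsSelfAdjoint s := by simp [IsSelfAdjoint, hs]
  have hherm : ∀ {C : Matrix ι ι 𝕜}, C.IsHermitian → (NormedSpace.exp (s • C)).IsHermitian :=
    fun {C} hC => IsHermitian.exp (by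
      rw [IsHermitian, conjTranspose_smul, hC.eq, hstar.star_eq])
  have hexp : ∀ C : Matrix ι ι 𝕜, NormedSpace.exp (s • C) ^ 2 ^ k = NormedSpace.exp C := by
    intro C
    rw [← exp_nsmul, ← Nat.cast_smul_eq_nsmul 𝕜, smul_smul, hs, mul_inv_cancel₀ (by simp),
      one_smul]
  refine ((re_trace_pow_two_pow_le k).2 _ _ (hherm hA) (hherm hB)).trans ?_
  rw [hexp, hexp]

end Matrix

/-! ### Spectral estimates for the matrix exponential -/

lemma Real.exp_le_one_add_add_sq {x : ℝ} (hx : |x| ≤ 1) : Real.exp x ≤ 1 + x + x ^ 2 := by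
  have h := (abs_le.mp (Real.abs_exp_sub_one_sub_id_le hx)).2
  linarith

namespace Matrix

variable {ι 𝕜 : Type*} [RCLike 𝕜] [Fintype ι] [DecidableEq ι]

open Unitary

lemma trace_conjStarAlgAut (U : unitaryGroup ι 𝕜) (M : Matrix ι ι 𝕜) :
    (conjStarAlgAut 𝕜 _ U M).trace = M.trace := by
  rw [conjStarAlgAut_apply, trace_mul_comm, ← mul_assoc, Unitary.coe_star_mul_self, one_mul]

lemma norm_conjStarAlgAut (U : unitaryGroup ι 𝕜) (M : Matrix ι ι 𝕜) :
    ‖conjStarAlgAut 𝕜 _ U M‖ = ‖M‖ := by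
  rw [conjStarAlgAut_apply, ← Unitary.coe_star, CStarRing.norm_mul_coe_unitary,
    CStarRing.norm_coe_unitary_mul]

lemma exp_conjStarAlgAut (U : unitaryGroup ι 𝕜) (M : Matrix ι ι 𝕜) :
    NormedSpace.exp (conjStarAlgAut 𝕜 _ U M) = conjStarAlgAut 𝕜 _ U (NormedSpace.exp M) := by
  have : CompleteSpace (Matrix ι ι 𝕜) := FiniteDimensional.complete 𝕜 _
  let _ := NormedAlgebra.restrictScalars ℚ 𝕜 (Matrix ι ι 𝕜)
  refine (NormedSpace.map_exp (conjStarAlgAut 𝕜 (Matrix ι ι 𝕜) U) ?_ M).symm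
  simp only [funext (conjStarAlgAut_apply U)]
  fun_prop

lemma exp_diagonal_ofReal (d : ι → ℝ) :
    NormedSpace.exp (diagonal fun i => (d i : 𝕜)) =
      diagonal fun i => ((Real.exp (d i) : ℝ) : 𝕜) := by
  rw [exp_diagonal]
  congr 1
  ext i
  rw [Pi.coe_exp, Real.exp_eq_exp_ℝ]
  exact (NormedSpace.map_exp (algebraMap ℝ 𝕜) (algebraMap_isometry ℝ 𝕜).continuous (d i)).symm

open scoped ComplexOrder in
lemma posSemidef_conjStarAlgAut_diagonal (U : unitaryGroup ι 𝕜) {d : ι → ℝ} (hd : ∀ i, 0 ≤ d i) :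
    (conjStarAlgAut 𝕜 _ U (diagonal fun i => (d i : 𝕜))).PosSemidef := by
  rw [conjStarAlgAut_apply, star_eq_conjTranspose]
  refine PosSemidef.mul_mul_conjTranspose_same (PosSemidef.diagonal fun i => ?_) _
  simpa using hd i

lemma IsHermitian.eq_conjStarAlgAut_diagonal {A : Matrix ι ι 𝕜} (hA : A.IsHermitian) :
    A = conjStarAlgAut 𝕜 _ hA.eigenvectorUnitary (diagonal fun i => (hA.eigenvalues i : 𝕜)) :=
  hA.spectral_theorem

lemma IsHermitian.exp_eq {A : Matrix ι ι 𝕜} (hA : A.IsHermitian) :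
    NormedSpace.exp A = conjStarAlgAut 𝕜 _ hA.eigenvectorUnitary
      (diagonal fun i => ((Real.exp (hA.eigenvalues i) : ℝ) : 𝕜)) := by
  conv_lhs => rw [hA.eq_conjStarAlgAut_diagonal, exp_conjStarAlgAut, exp_diagonal_ofReal]

open scoped ComplexOrder in
lemma IsHermitian.posSemidef_exp {A : Matrix ι ι 𝕜} (hA : A.IsHermitian) :
    (NormedSpace.exp A).PosSemidef := by
  rw [hA.exp_eq]
  exact posSemidef_conjStarAlgAut_diagonal _ fun i => Real.exp_nonneg _

lemma IsHermitian.norm_eq_norm_eigenvalues {A : Matrix ι ι 𝕜} (hA : A.IsHermitian) :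
    ‖A‖ = ‖fun i => (hA.eigenvalues i : 𝕜)‖ := by
  conv_lhs => rw [hA.eq_conjStarAlgAut_diagonal, norm_conjStarAlgAut, l2_opNorm_diagonal]

lemma IsHermitian.abs_eigenvalues_le_norm {A : Matrix ι ι 𝕜} (hA : A.IsHermitian) (i : ι) :
    |hA.eigenvalues i| ≤ ‖A‖ := by
  rw [hA.norm_eq_norm_eigenvalues]
  simpa using norm_le_pi_norm (fun i => (hA.eigenvalues i : 𝕜)) i

open scoped ComplexOrder in
/-- The Loewner inequality `exp Y ≤ 1 + Y + Y²` for a Hermitian contraction `Y`. -/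
lemma IsHermitian.posSemidef_one_add_add_sq_sub_exp {Y : Matrix ι ι 𝕜} (hY : Y.IsHermitian)
    (h1 : ‖Y‖ ≤ 1) :
    (1 + Y + Y ^ 2 - NormedSpace.exp Y).PosSemidef := by
  have h : 1 + Y + Y ^ 2 - NormedSpace.exp Y = conjStarAlgAut 𝕜 _ hY.eigenvectorUnitary
      (diagonal fun i => ((1 + hY.eigenvalues i + hY.eigenvalues i ^ 2 -
        Real.exp (hY.eigenvalues i) : ℝ) : 𝕜)) := by
    rw [hY.exp_eq]
    nth_rw 1 2 [hY.eq_conjStarAlgAut_diagonal]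
    rw [← map_pow, ← map_one (conjStarAlgAut 𝕜 (Matrix ι ι 𝕜) hY.eigenvectorUnitary), ← map_add,
      ← map_add, ← map_sub, diagonal_pow, ← diagonal_one, diagonal_add, diagonal_add, diagonal_sub]
    congr 2
    ext i
    simp
  rw [h]
  refine posSemidef_conjStarAlgAut_diagonal _ fun i => ?_
  linarith [Real.exp_le_one_add_add_sq ((hY.abs_eigenvalues_le_norm i).trans h1)]

open scoped ComplexOrder in
lemma PosSemidef.re_trace_mul_exp_le {W Y : Matrix ι ι 𝕜} (hW : W.PosSemidef)
    (hY : Y.IsHermitian) (h1 : ‖Y‖ ≤ 1) :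
    RCLike.re (W * NormedSpace.exp Y).trace ≤
      RCLike.re W.trace + RCLike.re (W * Y).trace + RCLike.re (W * Y ^ 2).trace := by
  have h := hW.re_trace_mul_nonneg (hY.posSemidef_one_add_add_sq_sub_exp h1)
  simp only [mul_sub, mul_add, mul_one, trace_sub, trace_add, map_sub, map_add] at h
  linarith

lemma norm_apply_le_l2_opNorm (A : Matrix ι ι 𝕜) (a b : ι) : ‖A a b‖ ≤ ‖A‖ := by
  have h := l2_opNorm_mulVec A (EuclideanSpace.single b 1)
  have h2 := PiLp.norm_apply_le (WithLp.toLp 2 (A *ᵥ (EuclideanSpace.single b (1 : 𝕜)).ofLp)) a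
  simp at h h2
  exact h2.trans h

open scoped ComplexOrder in
/-- Hölder's inequality for the trace norm and the operator norm. -/
lemma PosSemidef.re_trace_mul_le {A : Matrix ι ι 𝕜} (hA : A.PosSemidef) (B : Matrix ι ι 𝕜) :
    RCLike.re (A * B).trace ≤ ‖B‖ * RCLike.re A.trace := by
  set U := hA.1.eigenvectorUnitary
  set C := (conjStarAlgAut 𝕜 _ U).symm B
  have hB : B = conjStarAlgAut 𝕜 _ U C := ((conjStarAlgAut 𝕜 _ U).apply_symm_apply B).symm
  have hAd := hA.1.eq_conjStarAlgAut_diagonal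
  rw [hAd, hB, ← map_mul, trace_conjStarAlgAut, trace_conjStarAlgAut, norm_conjStarAlgAut]
  simp only [trace, diag_apply, diagonal_mul, diagonal_apply_eq, map_sum, Finset.mul_sum,
    RCLike.re_ofReal_mul, RCLike.ofReal_re]
  refine Finset.sum_le_sum fun i _ => ?_
  rw [mul_comm]
  exact mul_le_mul_of_nonneg_right ((RCLike.re_le_norm _).trans (norm_apply_le_l2_opNorm C i i))
    (hA.eigenvalues_nonneg i)

/-- The spectral radius `‖A‖` of a Hermitian matrix is attained at an eigenvalue of `A` or of
`-A`. -/
lemma IsHermitian.exp_norm_le [Nonempty ι] {A : Matrix ι ι 𝕜} (hA : A.IsHermitian) :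
    Real.exp ‖A‖ ≤
      RCLike.re (NormedSpace.exp A).trace + RCLike.re (NormedSpace.exp (-A)).trace := by
  set U := hA.eigenvectorUnitary
  set d := hA.eigenvalues
  have hneg : -A = conjStarAlgAut 𝕜 _ U (diagonal fun i => ((-d i : ℝ) : 𝕜)) := by
    conv_lhs => rw [hA.eq_conjStarAlgAut_diagonal]
    rw [← map_neg, diagonal_neg]
    congr 2
    ext i
    simp [d]
  rw [hneg, exp_conjStarAlgAut, exp_diagonal_ofReal, hA.exp_eq, trace_conjStarAlgAut,
    trace_conjStarAlgAut]
  simp only [trace, diag_apply, diagonal_apply_eq, map_sum, RCLike.ofReal_re]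
  obtain ⟨i, hi⟩ : ∃ i, ‖A‖ ≤ |d i| := by
    obtain ⟨i, hi⟩ := Finite.exists_max fun i => |d i|
    refine ⟨i, ?_⟩
    rw [hA.norm_eq_norm_eigenvalues]
    exact (pi_norm_le_iff_of_nonempty _).mpr fun j => by simpa using hi j
  have h1 := Finset.single_le_sum (f := fun i => Real.exp (d i))
    (fun j _ => Real.exp_nonneg _) (Finset.mem_univ i)
  have h2 := Finset.single_le_sum (f := fun i => Real.exp (-d i))
    (fun j _ => Real.exp_nonneg _) (Finset.mem_univ i)
  have h3 : Real.exp |d i| ≤ Real.exp (d i) + Real.exp (-d i) := by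
    rcases abs_cases (d i) with h | h <;> rw [h.1] <;>
      linarith [Real.exp_nonneg (d i), Real.exp_nonneg (-d i)]
  exact (Real.exp_le_exp.mpr hi).trans (h3.trans (add_le_add h1 h2))

end Matrix

/-! ### Expectations of random matrices -/

section RandomMatrix

variable {𝕜 Ω : Type*} [RCLike 𝕜] [MeasurableSpace Ω] {P : Measure Ω} {n : ℕ}

instance Matrix.instBorelSpacePi : BorelSpace (Matrix (Fin n) (Fin n) 𝕜) :=
  inferInstanceAs (BorelSpace (Fin n → Fin n → 𝕜))

instance Matrix.instSecondCountableTopologyPi :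
    SecondCountableTopology (Matrix (Fin n) (Fin n) 𝕜) :=
  inferInstanceAs (SecondCountableTopology (Fin n → Fin n → 𝕜))

lemma Matrix.measurable_apply (a b : Fin n) :
    Measurable fun M : Matrix (Fin n) (Fin n) 𝕜 => M a b :=
  (continuous_id.matrix_elem a b).measurable

lemma Matrix.measurable_exp :
    Measurable (NormedSpace.exp : Matrix (Fin n) (Fin n) 𝕜 → Matrix (Fin n) (Fin n) 𝕜) := by
  have : CompleteSpace (Matrix (Fin n) (Fin n) 𝕜) := FiniteDimensional.complete 𝕜 _
  let _ := NormedAlgebra.restrictScalars ℚ 𝕜 (Matrix (Fin n) (Fin n) 𝕜)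
  exact NormedSpace.exp_continuous.measurable

lemma integrable_matrix_apply_of_norm_le [IsFiniteMeasure P] {F : Ω → Matrix (Fin n) (Fin n) 𝕜}
    (hF : Measurable F) {C : ℝ} (hC : ∀ᵐ ω ∂P, ‖F ω‖ ≤ C) (a b : Fin n) :
    Integrable (fun ω => F ω a b) P :=
  Integrable.of_bound ((Matrix.measurable_apply a b).comp hF).aestronglyMeasurable C
    (hC.mono fun ω h => (Matrix.norm_apply_le_l2_opNorm (F ω) a b).trans h)

lemma integrable_re_trace {F : Ω → Matrix (Fin n) (Fin n) 𝕜}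
    (hF : ∀ a b, Integrable (fun ω => F ω a b) P) :
    Integrable (fun ω => RCLike.re (F ω).trace) P :=
  (integrable_finsetSum _ fun a _ => hF a a).re

lemma integral_re_trace {F : Ω → Matrix (Fin n) (Fin n) 𝕜}
    (hF : ∀ a b, Integrable (fun ω => F ω a b) P) :
    ∫ ω, RCLike.re (F ω).trace ∂P = RCLike.re (matrixExpectation P F).trace := by
  have h := integral_re (μ := P) (f := fun ω => (F ω).trace)
    (integrable_finsetSum _ fun a _ => hF a a)
  rw [h]
  congr 1
  simp only [Matrix.trace, Matrix.diag_apply, matrixExpectation, Matrix.of_apply]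
  exact integral_finsetSum _ fun a _ => hF a a

lemma integrable_matrix_mul_apply {W Z : Ω → Matrix (Fin n) (Fin n) 𝕜} (h : IndepFun W Z P)
    (hW : ∀ a b, Integrable (fun ω => W ω a b) P) (hZ : ∀ a b, Integrable (fun ω => Z ω a b) P)
    (a b : Fin n) : Integrable (fun ω => (W ω * Z ω) a b) P := by
  simp only [Matrix.mul_apply]
  exact integrable_finsetSum _ fun k _ => (h.comp (Matrix.measurable_apply a k)
    (Matrix.measurable_apply k b)).integrable_mul (hW a k) (hZ k b)

lemma matrixExpectation_mul {W Z : Ω → Matrix (Fin n) (Fin n) 𝕜} (h : IndepFun W Z P)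
    (hW : ∀ a b, Integrable (fun ω => W ω a b) P) (hZ : ∀ a b, Integrable (fun ω => Z ω a b) P) :
    matrixExpectation P (fun ω => W ω * Z ω) = matrixExpectation P W * matrixExpectation P Z := by
  ext a b
  have hi : ∀ k, IndepFun (fun ω => W ω a k) (fun ω => Z ω k b) P := fun k =>
    h.comp (Matrix.measurable_apply a k) (Matrix.measurable_apply k b)
  simp only [matrixExpectation, Matrix.of_apply, Matrix.mul_apply]
  refine (integral_finsetSum _ fun k _ => (hi k).integrable_mul (hW a k) (hZ k b)).trans ?_
  exact Finset.sum_congr rfl fun k _ => (hi k).integral_fun_mul_eq_mul_integral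
    (hW a k).aestronglyMeasurable (hZ k b).aestronglyMeasurable

/-- A random positive semidefinite matrix sees an independent random matrix only through the norm
of its expectation. -/
lemma integral_re_trace_mul_le [IsProbabilityMeasure P] {W Z : Ω → Matrix (Fin n) (Fin n) 𝕜}
    (h : IndepFun W Z P) (hW : ∀ a b, Integrable (fun ω => W ω a b) P)
    (hZ : ∀ a b, Integrable (fun ω => Z ω a b) P)
    (hpos : open scoped ComplexOrder in ∀ᵐ ω ∂P, (W ω).PosSemidef) :
    ∫ ω, RCLike.re (W ω * Z ω).trace ∂P ≤
      ‖matrixExpectation P Z‖ * ∫ ω, RCLike.re (W ω).trace ∂P := by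
  have hconst : IndepFun W (fun _ => matrixExpectation P Z) P := indepFun_const_right _ _
  have hi : ∀ a b, Integrable (fun _ : Ω => matrixExpectation P Z a b) P :=
    fun a b => integrable_const _
  have hE : matrixExpectation P (fun _ : Ω => matrixExpectation P Z) = matrixExpectation P Z := by
    ext a b; simp [matrixExpectation]
  calc ∫ ω, RCLike.re (W ω * Z ω).trace ∂P
      = ∫ ω, RCLike.re (W ω * matrixExpectation P Z).trace ∂P := by
        rw [integral_re_trace (integrable_matrix_mul_apply h hW hZ),
          integral_re_trace (integrable_matrix_mul_apply hconst hW hi),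
          matrixExpectation_mul h hW hZ, matrixExpectation_mul hconst hW hi, hE]
    _ ≤ ∫ ω, ‖matrixExpectation P Z‖ * RCLike.re (W ω).trace ∂P :=
        integral_mono_ae (integrable_re_trace (integrable_matrix_mul_apply hconst hW hi))
          ((integrable_re_trace hW).const_mul _) (hpos.mono fun ω hω => hω.re_trace_mul_le _)
    _ = _ := integral_const_mul _ _

end RandomMatrix

/-! ### The trace of the matrix moment generating function -/

section TraceMGF

variable {𝕜 Ω : Type*} [RCLike 𝕜] [MeasurableSpace Ω] {P : Measure Ω}
  {n : ℕ} {α : Type*} {Y : α → Ω → Matrix (Fin n) (Fin n) 𝕜}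

lemma ae_isHermitian_sum (hherm : ∀ i, ∀ᵐ ω ∂P, (Y i ω).IsHermitian) (s : Finset α) :
    ∀ᵐ ω ∂P, (∑ i ∈ s, Y i ω).IsHermitian := by
  have h : ∀ᵐ ω ∂P, ∀ i ∈ s, (Y i ω).IsHermitian :=
    (ae_ball_iff s.countable_toSet).mpr fun i _ => hherm i
  filter_upwards [h] with ω hω
  rw [Matrix.IsHermitian, Matrix.conjTranspose_sum]
  exact Finset.sum_congr rfl fun i hi => (hω i hi).eq

variable [NeZero n]

lemma ae_norm_exp_sum_le (hbound : ∀ i, ∀ᵐ ω ∂P, ‖Y i ω‖ ≤ 1) (s : Finset α) :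
    ∀ᵐ ω ∂P, ‖NormedSpace.exp (∑ i ∈ s, Y i ω)‖ ≤ Real.exp s.card := by
  have h : ∀ᵐ ω ∂P, ∀ i ∈ s, ‖Y i ω‖ ≤ 1 :=
    (ae_ball_iff s.countable_toSet).mpr fun i _ => hbound i
  filter_upwards [h] with ω hω
  refine (NormedSpace.norm_exp_le_exp_norm 𝕜 _).trans (Real.exp_le_exp.mpr ?_)
  refine (norm_sum_le _ _).trans ((Finset.sum_le_card_nsmul s _ 1 hω).trans (by simp))

variable [IsProbabilityMeasure P]

lemma integrable_exp_sum_apply (hmeas : ∀ i, Measurable (Y i))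
    (hbound : ∀ i, ∀ᵐ ω ∂P, ‖Y i ω‖ ≤ 1) (s : Finset α) (a b : Fin n) :
    Integrable (fun ω => NormedSpace.exp (∑ i ∈ s, Y i ω) a b) P :=
  integrable_matrix_apply_of_norm_le
    (Matrix.measurable_exp.comp (Finset.measurable_sum s fun i _ => hmeas i))
    (ae_norm_exp_sum_le hbound s) a b

/-- The Ahlswede–Winter recursion: one summand at a time is split off by the Golden–Thompson
inequality, and its exponential, being at most `1 + Y + Y²`, costs a factor `1 + v ≤ exp v`. -/
theorem integral_re_trace_exp_sum_le
    (hmeas : ∀ i, Measurable (Y i)) (hherm : ∀ i, ∀ᵐ ω ∂P, (Y i ω).IsHermitian)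
    (hindep : iIndepFun Y P) (hmean : ∀ i, matrixExpectation P (Y i) = 0) {v : ℝ}
    (hvar : ∀ i, ‖matrixExpectation P (fun ω => Y i ω ^ 2)‖ ≤ v)
    (hbound : ∀ i, ∀ᵐ ω ∂P, ‖Y i ω‖ ≤ 1) (s : Finset α) :
    ∫ ω, RCLike.re (NormedSpace.exp (∑ i ∈ s, Y i ω)).trace ∂P ≤ n * Real.exp (s.card * v) := by
  classical
  induction s using Finset.induction_on with
  | empty => simp
  | insert j s hj ih =>
    set W : Ω → Matrix (Fin n) (Fin n) 𝕜 := fun ω => NormedSpace.exp (∑ i ∈ s, Y i ω)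
    have hsum : IndepFun (fun ω => ∑ i ∈ s, Y i ω) (Y j) P := by
      have h := hindep.indepFun_finsetSum_of_notMem hmeas hj
      rwa [Finset.sum_fn] at h
    have hW : ∀ a b, Integrable (fun ω => W ω a b) P := integrable_exp_sum_apply hmeas hbound s
    have hY1 : ∀ a b, Integrable (fun ω => Y j ω a b) P :=
      integrable_matrix_apply_of_norm_le (hmeas j) (hbound j)
    have hY2 : ∀ a b, Integrable (fun ω => (Y j ω ^ 2) a b) P :=
      integrable_matrix_apply_of_norm_le (C := 1) ((hmeas j).pow_const 2) (by
        filter_upwards [hbound j] with ω hω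
        exact (norm_pow_le _ _).trans (pow_le_one₀ (norm_nonneg _) hω))
    have hind1 : IndepFun W (Y j) P := hsum.comp Matrix.measurable_exp measurable_id
    have hind2 : IndepFun W (fun ω => Y j ω ^ 2) P :=
      hsum.comp Matrix.measurable_exp (measurable_id.pow_const 2)
    have hpos : open scoped ComplexOrder in ∀ᵐ ω ∂P, (W ω).PosSemidef :=
      (ae_isHermitian_sum hherm s).mono fun ω hω => hω.posSemidef_exp
    have hlin : ∫ ω, RCLike.re (W ω * Y j ω).trace ∂P = 0 := by
      rw [integral_re_trace (integrable_matrix_mul_apply hind1 hW hY1),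
        matrixExpectation_mul hind1 hW hY1, hmean]
      simp
    have hI0 := integrable_re_trace hW
    have hI1 := integrable_re_trace (integrable_matrix_mul_apply hind1 hW hY1)
    have hI2 := integrable_re_trace (integrable_matrix_mul_apply hind2 hW hY2)
    have hI01 : Integrable (fun ω => RCLike.re (W ω).trace + RCLike.re (W ω * Y j ω).trace) P :=
      hI0.add hI1
    have htr : 0 ≤ ∫ ω, RCLike.re (W ω).trace ∂P := by
      refine integral_nonneg_of_ae (hpos.mono fun ω hω => ?_)
      open scoped ComplexOrder in exact (RCLike.nonneg_iff.mp hω.trace_nonneg).1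
    have hle : ∀ᵐ ω ∂P, RCLike.re (NormedSpace.exp (∑ i ∈ insert j s, Y i ω)).trace ≤
        RCLike.re (W ω).trace + RCLike.re (W ω * Y j ω).trace +
          RCLike.re (W ω * Y j ω ^ 2).trace := by
      filter_upwards [ae_isHermitian_sum hherm s, hherm j, hbound j, hpos] with ω h1 h2 h3 h4
      rw [Finset.sum_insert hj, add_comm]
      exact (h1.re_trace_exp_add_le h2).trans (h4.re_trace_mul_exp_le h2 h3)
    calc ∫ ω, RCLike.re (NormedSpace.exp (∑ i ∈ insert j s, Y i ω)).trace ∂P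
        ≤ ∫ ω, (RCLike.re (W ω).trace + RCLike.re (W ω * Y j ω).trace +
          RCLike.re (W ω * Y j ω ^ 2).trace) ∂P :=
          integral_mono_ae (integrable_re_trace (integrable_exp_sum_apply hmeas hbound _))
            (hI01.add hI2) hle
      _ = ∫ ω, RCLike.re (W ω).trace ∂P + ∫ ω, RCLike.re (W ω * Y j ω ^ 2).trace ∂P := by
          rw [integral_add hI01 hI2, integral_add hI0 hI1, hlin, add_zero]
      _ ≤ ∫ ω, RCLike.re (W ω).trace ∂P + v * ∫ ω, RCLike.re (W ω).trace ∂P := by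
          gcongr
          exact (integral_re_trace_mul_le hind2 hW hY2 hpos).trans
            (mul_le_mul_of_nonneg_right (hvar j) htr)
      _ = (v + 1) * ∫ ω, RCLike.re (W ω).trace ∂P := by ring
      _ ≤ Real.exp v * (n * Real.exp (s.card * v)) :=
          mul_le_mul (Real.add_one_le_exp v) ih htr (Real.exp_nonneg _)
      _ = n * Real.exp ((insert j s).card * v) := by
          rw [Finset.card_insert_of_notMem hj, mul_left_comm, ← Real.exp_add]
          push_cast
          ring_nf

end TraceMGF

/-! ### The tail bound -/

/-- The Chernoff bound for the norm of the sum, before the choice of the parameter `r`. -/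
theorem measureReal_lt_norm_sum_le {𝕜 Ω α : Type*} [RCLike 𝕜] [MeasurableSpace Ω]
    {P : Measure Ω} [IsProbabilityMeasure P] {n : ℕ} [NeZero n] [Fintype α]
    {X : α → Ω → Matrix (Fin n) (Fin n) 𝕜}
    (hmeas : ∀ i, Measurable (X i)) (hherm : ∀ i, ∀ᵐ ω ∂P, (X i ω).IsHermitian)
    (hindep : iIndepFun X P) (hmean : ∀ i, matrixExpectation P (X i) = 0) {v c r : ℝ}
    (hvar : ∀ i, ‖matrixExpectation P (fun ω => X i ω ^ 2)‖ ≤ v)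
    (hbound : ∀ i, ∀ᵐ ω ∂P, ‖X i ω‖ ≤ c) (hr : 0 ≤ r) (hrc : r * c ≤ 1) (t : ℝ) :
    P.real {ω | t < ‖∑ i, X i ω‖} ≤
      2 * n * Real.exp (Fintype.card α * (r ^ 2 * v) - r * t) := by
  -- Both `r • X` and `-r • X` are centred contractions, to which the trace bound applies.
  have key : ∀ q : ℝ, |q| = r →
      (∀ i, Measurable fun ω => (q : 𝕜) • X i ω) ∧
      (∀ i, ∀ᵐ ω ∂P, ‖(q : 𝕜) • X i ω‖ ≤ 1) ∧
      ∫ ω, RCLike.re (NormedSpace.exp ((q : 𝕜) • ∑ i, X i ω)).trace ∂P ≤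
        n * Real.exp (Fintype.card α * (r ^ 2 * v)) := by
    intro q hq
    have hsq : q ^ 2 = r ^ 2 := by rw [← hq, sq_abs]
    have h1 : ∀ i, Measurable fun ω => (q : 𝕜) • X i ω := fun i =>
      (measurable_const_smul _).comp (hmeas i)
    have h2 : ∀ i, ∀ᵐ ω ∂P, ‖(q : 𝕜) • X i ω‖ ≤ 1 := fun i => by
      filter_upwards [hbound i] with ω hω
      rw [norm_smul, RCLike.norm_ofReal, hq]
      exact (mul_le_mul_of_nonneg_left hω hr).trans hrc
    refine ⟨h1, h2, ?_⟩
    simp only [Finset.smul_sum]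
    refine integral_re_trace_exp_sum_le h1 (fun i => ?_)
      (hindep.comp (fun _ M => (q : 𝕜) • M) fun _ => measurable_const_smul _) (fun i => ?_)
      (fun i => ?_) h2 Finset.univ
    · filter_upwards [hherm i] with ω hω
      rw [Matrix.IsHermitian, Matrix.conjTranspose_smul, hω.eq]
      simp
    · ext a b
      have := congrFun (congrFun (hmean i) a) b
      simp only [matrixExpectation, Matrix.of_apply, Matrix.smul_apply, smul_eq_mul] at this ⊢
      rw [integral_const_mul, this]
      simp
    · have h : matrixExpectation P (fun ω => ((q : 𝕜) • X i ω) ^ 2) =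
          ((q ^ 2 : ℝ) : 𝕜) • matrixExpectation P (fun ω => X i ω ^ 2) := by
        ext a b
        simp only [matrixExpectation, Matrix.of_apply, Matrix.smul_apply, smul_eq_mul, smul_pow]
        rw [integral_const_mul]
        simp
      rw [h, norm_smul, RCLike.norm_ofReal, abs_of_nonneg (sq_nonneg q), hsq]
      exact mul_le_mul_of_nonneg_left (hvar i) (sq_nonneg r)
  obtain ⟨hm1, hb1, hi1⟩ := key r (abs_of_nonneg hr)
  obtain ⟨hm2, hb2, hi2⟩ := key (-r) (by rw [abs_neg, abs_of_nonneg hr])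
  have hint1 := integrable_re_trace (integrable_exp_sum_apply hm1 hb1 Finset.univ)
  have hint2 := integrable_re_trace (integrable_exp_sum_apply hm2 hb2 Finset.univ)
  simp only [← Finset.smul_sum] at hint1 hint2
  set f : Ω → ℝ := fun ω => RCLike.re (NormedSpace.exp ((r : 𝕜) • ∑ i, X i ω)).trace +
    RCLike.re (NormedSpace.exp (((-r : ℝ) : 𝕜) • ∑ i, X i ω)).trace
  have hfle : ∀ᵐ ω ∂P, Real.exp (r * ‖∑ i, X i ω‖) ≤ f ω := by
    filter_upwards [ae_isHermitian_sum hherm Finset.univ] with ω hω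
    have hr' : ((r : 𝕜) • ∑ i, X i ω).IsHermitian := by
      rw [Matrix.IsHermitian, Matrix.conjTranspose_smul, hω.eq]
      simp
    have h := hr'.exp_norm_le
    rw [norm_smul, RCLike.norm_ofReal, abs_of_nonneg hr, ← neg_smul, ← RCLike.ofReal_neg] at h
    exact h
  have hmarkov := mul_meas_ge_le_integral_of_nonneg (μ := P) (f := f)
    (hfle.mono fun ω h => (Real.exp_nonneg _).trans h) (hint1.add hint2) (Real.exp (r * t))
  have hint : ∫ ω, f ω ∂P ≤ 2 * n * Real.exp (Fintype.card α * (r ^ 2 * v)) := by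
    rw [integral_add hint1 hint2]
    linarith
  have hmono : P.real {ω | t < ‖∑ i, X i ω‖} ≤ P.real {ω | Real.exp (r * t) ≤ f ω} := by
    refine ENNReal.toReal_mono (measure_ne_top _ _) (measure_mono_ae ?_)
    filter_upwards [hfle] with ω hω ht
    refine le_trans (Real.exp_le_exp.mpr ?_) hω
    exact mul_le_mul_of_nonneg_left (le_of_lt ht) hr
  rw [Real.exp_sub, mul_div_assoc', le_div_iff₀' (Real.exp_pos _)]
  exact (mul_le_mul_of_nonneg_left hmono (Real.exp_nonneg _)).trans (hmarkov.trans hint)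

theorem theorem4 {𝕜 : Type*} [RCLike 𝕜] {Ω : Type*} [MeasurableSpace Ω]
    (P : Measure Ω) [IsProbabilityMeasure P]
    (n m : ℕ) (X : Fin m → Ω → Matrix (Fin n) (Fin n) 𝕜)
    (hmeas : ∀ i, Measurable (X i))
    (hherm : ∀ i, ∀ᵐ ω ∂P, (X i ω).IsHermitian)
    (hindep : iIndepFun X P)
    (hident : ∀ i j, IdentDistrib (X i) (X j) P P)
    (hmean : ∀ i, matrixExpectation P (X i) = 0)
    (V₀ c : ℝ)
    (hvar : ∀ i, ‖matrixExpectation P (fun ω => X i ω ^ 2)‖ ≤ V₀ ^ 2)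
    (hbound : ∀ i, ∀ᵐ ω ∂P, ‖X i ω‖ ≤ c)
    (V : ℝ) (hV : V = m * V₀ ^ 2) (t : ℝ) (ht : 0 ≤ t) :
    (t ≤ 2 * V / c →
      P.real {ω | t < ‖∑ i, X i ω‖} ≤ 2 * n * Real.exp (-(t ^ 2 / (4 * V)))) ∧
    (2 * V / c < t →
      P.real {ω | t < ‖∑ i, X i ω‖} ≤ 2 * n * Real.exp (-(t / (2 * c)))) := by
  -- If `n = 0` or `m = 0`, the sum is zero and the event is empty.
  have hzero : (∀ ω, ∑ i, X i ω = 0) → P.real {ω | t < ‖∑ i, X i ω‖} = 0 := fun h => by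
    simp [h, not_lt.mpr ht]
  rcases Nat.eq_zero_or_pos n with rfl | hn
  · have h := hzero fun ω => Subsingleton.elim _ _
    constructor <;> intro <;> rw [h] <;> positivity
  rcases Nat.eq_zero_or_pos m with rfl | hm
  · have h := hzero fun ω => by simp
    constructor <;> intro <;> rw [h] <;> positivity
  have : NeZero n := ⟨hn.ne.symm⟩
  have hn1 : (1 : ℝ) ≤ n := by exact_mod_cast hn
  have hone : P.real {ω | t < ‖∑ i, X i ω‖} ≤ 2 * n := measureReal_le_one.trans (by linarith)
  have hc0 : 0 ≤ c := by
    obtain ⟨ω, hω⟩ := (hbound ⟨0, hm⟩).exists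
    exact (norm_nonneg _).trans hω
  have hV0 : 0 ≤ V := by rw [hV]; positivity
  have hchernoff : ∀ r : ℝ, 0 ≤ r → r * c ≤ 1 →
      P.real {ω | t < ‖∑ i, X i ω‖} ≤ 2 * n * Real.exp (r ^ 2 * V - r * t) := fun r hr hrc => by
    have h := measureReal_lt_norm_sum_le hmeas hherm hindep hmean hvar hbound hr hrc t
    rwa [Fintype.card_fin, mul_left_comm, ← hV] at h
  -- Where `V` or `c` vanishes, the convention `x / 0 = 0` makes the bound at least `2 n`.
  constructor
  · intro htV
    rcases hV0.eq_or_lt with rfl | hVpos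
    · simpa using hone
    rcases hc0.eq_or_lt with rfl | hcpos
    · have : t = 0 := le_antisymm (by simpa using htV) ht
      simpa [this] using hone
    -- The optimal parameter is `t / (2V)`.
    refine (hchernoff (t / (2 * V)) (by positivity) ?_).trans_eq ?_
    · rw [div_mul_eq_mul_div, div_le_one (by positivity)]
      exact (le_div_iff₀ hcpos).mp htV
    · congr 2
      field_simp
      ring
  · intro htV
    rcases hc0.eq_or_lt with rfl | hcpos
    · simpa using hone
    -- The unconstrained optimum exceeds `1 / c`, the largest admissible parameter.
    refine (hchernoff (1 / c) (by positivity) (by field_simp; exact le_rfl)).trans ?_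
    gcongr
    rw [div_lt_iff₀ hcpos] at htV
    have h : (1 / c) ^ 2 * V - 1 / c * t - -(t / (2 * c)) = (2 * V - t * c) / (2 * c ^ 2) := by
      field_simp
      ring
    have h2 : (2 * V - t * c) / (2 * c ^ 2) ≤ 0 :=
      div_nonpos_of_nonpos_of_nonneg (by linarith) (by positivity)
    linarith
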